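/- **Setting.** Let $M,m,l_F,\eta\ge 1$ and $L_U\ge 2$ be integers, $\alpha\in[0,1]$, $\gamma\ge 0$, $P_B,P_c>0$. Put $n_F=m\,l_F$ (radio frequency channels), $l_S=m\,\eta$ (twisted pairs per cable) and $\mu=l_F/n_F=1/m$, so that $\eta=\mu l_S$. Let $\mathbf H\in\mathbb R^{M\times M}$ be the circulant Wyner matrix with first column $[1,\alpha,0,\dots,0,\alpha]^T$ (that is, $(\mathbf x^T\mathbf H)_k=x_k+\alpha x_{k-1}+\alpha x_{k+1}$ with cyclic indices), $\mathbf H_c=\gamma\mathbf 1_{l_S}\mathbf 1_{l_S}^T+(1-\gamma)\mathbf I_{l_S}$ the fronthaul channel, $\mathbf H_c^\eta=\gamma\eta\,\mathbf 1_m\mathbf 1_m^T+(1-\gamma)\mathbf I_m$, $\mathbf G=\frac1\eta(\mathbf I_m\otimes\mathbf 1_\eta)$ the combining matrix, $\bar P_B=P_B(1-L_U^{-1})^{-1}$ and $\lambda=\sqrt{P_c/(\bar P_B(1+2\alpha^2)+1)}$. A frame has minislots $t=1,\dots,n_T$. Under orthogonal multiple access (OMA) the minislots $L_U,2L_U,\dots$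 are reserved for URLLC traffic; on each of the other minislots the $M$ eMBB users send $\mathbf X(t)\in\mathbb C^{n_F\times M}$ with i.i.d. $\mathcal{CN}(0,\bar P_B)$ entries and the edge nodes receive $\mathbf Y(t)=\mathbf X(t)\mathbf H+\mathbf Z(t)$, with $k$-th column $\mathbf y_k(t)$. Edge node $k$ reshapes $\mathbf y_k(t)$ columnwise into an $l_F\times m$ matrix $\mathbf Y_k(t)$, sends $\lambda\,\mathbf Y_k(t)\otimes\mathbf 1_\eta^T$ over its cable, and the baseband unit (BBU) obtains, after combining and normalization by $\lambda$, $$\mathbf r_k(t)=\mathrm{vec}\left[\lambda^{-1}\left((\lambda\,\mathbf Y_k(t)\otimes\mathbf 1_\eta^T)\mathbf H_c+\tilde{\mathbf W}_k(t)\right)\mathbf G\right].$$ The entries of all $\mathbf Z(t)$ and $\tilde{\mathbf W}_k(t)$ are i.i.d. $\mathcal{CN}(0,1)$ and independent of the eMBB symbols. Let $\mathbf x$ and $\mathbf r$ collect all $\mathbf X(t)$ and all $\mathbf r_k(t)$ over the eMBB minislots of the frame. The per-user eMBB rate (bits per radio resource) of a frame of $n_T\ge1$ minislots is $$R_B(n_T)=\frac{1}{M\,n_T\,n_F}\,I(\mathbf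 x;\mathbf r),$$ where $I$ is the mutual information in bits. **Claim.** For every $n_T$, $I(\mathbf x;\mathbf r)$ is finite. If $L_U$ divides $n_T\ge 1$, then $R_B(n_T)=R_B$, where $$R_B=\mu\,\frac{1-L_U^{-1}}{M}\,\log_2\det\left(\mathbf I+\bar P_B\,\mathbf R_{z_{\rm eq}}^{-1}\mathbf H_{\rm eq}\mathbf H_{\rm eq}^T\right),\qquad \mathbf H_{\rm eq}=\mathbf H\otimes\mathbf H_c^\eta,\qquad \mathbf R_{z_{\rm eq}}=\mathbf I_M\otimes(\mathbf H_c^\eta)^2+\frac{1}{\lambda^2\eta}\mathbf I_{Mm}.$$ Moreover $R_B(n_T)\to R_B$ as $n_T\to\infty$. -/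

import Mathlib

noncomputable section

open MeasureTheory ProbabilityTheory InformationTheory

/-! ### Generic notions -/

/-- Mutual information `I(X; Y)`, in nats, of two random variables on a common probability space:
the Kullback-Leibler divergence of their joint law from the product of their marginal laws. -/
def mutualInfo {Ω E F : Type*} [MeasurableSpace Ω] [MeasurableSpace E] [MeasurableSpace F]
    (P : Measure Ω) (X : Ω → E) (Y : Ω → F) : ENNReal :=
  klDiv (P.map fun ω => (X ω, Y ω)) ((P.map X).prod (P.map Y))

/-- The circularly-symmetric complex Gaussian law `CN(0, v)`: independent real and imaginary parts,
each of law `N(0, v / 2)`. -/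
def complexGaussian (v : ℝ) : Measure ℂ :=
  ((gaussianReal 0 (v / 2).toNNReal).prod (gaussianReal 0 (v / 2).toNNReal)).map
    fun p => (p.1 : ℂ) + (p.2 : ℂ) * Complex.I

/-- The law `CN(0, v I)` of a vector with i.i.d. `CN(0, v)` entries. -/
def whiteComplexGaussian (ι : Type*) [Fintype ι] (v : ℝ) : Measure (ι → ℂ) :=
  Measure.pi fun _ => complexGaussian v

/-- The column-stacked vectorization reversed: the matrix `A` with `Matrix.vec A = y`. -/
def unvec {κ ι : Type*} (y : κ × ι → ℂ) : Matrix ι κ ℂ :=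
  Matrix.of fun i j => y (j, i)

/-! ### The C-RAN with analog fronthaul -/

/-- The scalar parameters of the C-RAN. -/
structure CRAN where
  /-- number of cells, that is of eMBB users and of edge nodes -/
  M : ℕ
  /-- number `1 / μ` of sub-bands into which the radio band is split -/
  m : ℕ
  /-- number of cable frequency channels on each twisted pair -/
  lF : ℕ
  /-- bandwidth amplification factor: number of pairs carrying each sub-band -/
  η : ℕ
  /-- one minislot out of `LU` is reserved to URLLC -/
  LU : ℕ
  /-- inter-cell gain -/
  α : ℝ
  /-- cable crosstalk coefficient -/
  γ : ℝ
  /-- eMBB power budget -/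
  PB : ℝ
  /-- cable power budget -/
  Pc : ℝ
  M_pos : 1 ≤ M
  m_pos : 1 ≤ m
  lF_pos : 1 ≤ lF
  η_pos : 1 ≤ η
  two_le_LU : 2 ≤ LU
  α_mem : α ∈ Set.Icc (0 : ℝ) 1
  γ_nonneg : 0 ≤ γ
  PB_pos : 0 < PB
  Pc_pos : 0 < Pc

namespace CRAN

variable (p : CRAN)

instance : NeZero p.M := ⟨Nat.one_le_iff_ne_zero.mp p.M_pos⟩

/-- Number of radio frequency channels. -/
def nF : ℕ := p.m * p.lF

/-- Number of twisted pairs of each cable. -/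
def lS : ℕ := p.m * p.η

/-- Normalized cable bandwidth `μ = lF / nF`. -/
def μ : ℝ := (p.lF : ℝ) / (p.nF : ℝ)

/-- Radio frequency channels; `(j, f')` is channel `f'` of sub-band `j`. There are `nF` of them. -/
abbrev Freq : Type := Fin p.m × Fin p.lF

/-- Twisted pairs; `(j, i)` is the `i`-th pair carrying sub-band `j`. There are `lS` of them. -/
abbrev Pair : Type := Fin p.m × Fin p.η

/-- The minislots of `{1, ..., nT}` that OMA leaves to the eMBB users: all except
`LU, 2 LU, ...`. The element `t` of `Fin nT` stands for minislot number `t + 1`. -/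
abbrev EMBBSlot (nT : ℕ) : Type := {t : Fin nT // ¬ p.LU ∣ (t : ℕ) + 1}

/-- The eMBB transmission power on the eMBB minislots under OMA. -/
def PBbar : ℝ := p.PB * (1 - (p.LU : ℝ)⁻¹)⁻¹

/-- The fronthaul gain `λ` under OMA. -/
def gain : ℝ :=
  √(p.Pc / ((1 - (p.LU : ℝ)⁻¹)⁻¹ * p.PB * (1 + 2 * p.α ^ 2) + 1))

/-- The circulant Wyner channel matrix, with first column `[1, α, 0, ..., 0, α]`. Edge node `k`
hears user `k` with gain `1` and users `k - 1`, `k + 1` (cyclically) with gain `α` each. -/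
def H : Matrix (Fin p.M) (Fin p.M) ℝ :=
  Matrix.circulant fun d =>
    (if d = 0 then 1 else 0) + (if d = 1 then p.α else 0) + (if d = -1 then p.α else 0)

/-- The fronthaul channel matrix `γ 1 1ᵀ + (1 - γ) I`, of size `lS`. -/
def Hc : Matrix p.Pair p.Pair ℝ :=
  p.γ • Matrix.of (fun _ _ => 1) + (1 - p.γ) • 1

/-- The combining matrix `(1 / η) (I ⊗ 1_η)`, of size `lS` times `1 / μ`. -/
def G : Matrix p.Pair (Fin p.m) ℝ :=
  Matrix.of fun c j => if c.1 = j then (p.η : ℝ)⁻¹ else 0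

/-! ### The signal chain -/

/-- Index set of the radio signals (minislot, frequency, cell) of one frame. -/
abbrev RadioIdx (nT : ℕ) : Type := p.EMBBSlot nT × p.Freq × Fin p.M

/-- Index set of the cable noise (minislot, edge node, cable frequency, pair) of one frame. -/
abbrev CableIdx (nT : ℕ) : Type := p.EMBBSlot nT × Fin p.M × Fin p.lF × p.Pair

/-- Sample space of one frame: eMBB symbols, radio noise, cable noise. -/
abbrev Sample (nT : ℕ) : Type :=
  (p.RadioIdx nT → ℂ) × (p.RadioIdx nT → ℂ) × (p.CableIdx nT → ℂ)

/-- Law of one frame: i.i.d. `CN(0, PBbar)` eMBB symbols, `CN(0, 1)` radio noise and `CN(0, 1)`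
cable noise, all independent. -/
def law (nT : ℕ) : Measure (p.Sample nT) :=
  (whiteComplexGaussian (p.RadioIdx nT) p.PBbar).prod
    ((whiteComplexGaussian (p.RadioIdx nT) 1).prod (whiteComplexGaussian (p.CableIdx nT) 1))

variable {p}

/-- All eMBB symbols of the frame. -/
def X {nT : ℕ} (ω : p.Sample nT) : p.RadioIdx nT → ℂ := ω.1

/-- The signal `Y(t) = X(t) H + Z(t)` received at the edge nodes in eMBB minislot `t`. -/
def Y {nT : ℕ} (ω : p.Sample nT) (t : p.EMBBSlot nT) : Matrix p.Freq (Fin p.M) ℂ :=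
  Matrix.of (fun f k => ω.1 (t, f, k)) * p.H.map Complex.ofReal
    + Matrix.of (fun f k => ω.2.1 (t, f, k))

/-- The signal that edge node `k` sends over its cable: each sub-band of its received signal,
scaled by `λ`, is repeated on `η` twisted pairs, that is `λ (unvec y_k ⊗ 1_ηᵀ)`. -/
def cableInput {nT : ℕ} (ω : p.Sample nT) (t : p.EMBBSlot nT) (k : Fin p.M) :
    Matrix (Fin p.lF) p.Pair ℂ :=
  Matrix.of fun f' c => (p.gain : ℂ) * unvec (fun f => Y ω t f k) f' c.1

/-- The signal at the output of the cable of edge node `k`: crosstalk and white cable noise. -/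
def cableOutput {nT : ℕ} (ω : p.Sample nT) (t : p.EMBBSlot nT) (k : Fin p.M) :
    Matrix (Fin p.lF) p.Pair ℂ :=
  cableInput ω t k * p.Hc.map Complex.ofReal + Matrix.of (fun f' c => ω.2.2 (t, k, f', c))

/-- The signal `r_k` at the BBU after maximum ratio combining, over all radio frequencies. It is
normalized by `1 / λ`, so that the transmit scaling `λ` shows up as a scaling of the cable noise. -/
def combined {nT : ℕ} (ω : p.Sample nT) (t : p.EMBBSlot nT) (k : Fin p.M) : p.Freq → ℂ :=
  Matrix.vec ((p.gain : ℂ)⁻¹ • (cableOutput ω t k * p.G.map Complex.ofReal))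

/-- The overall signal available at the BBU over the eMBB minislots of the frame. -/
def R {nT : ℕ} (ω : p.Sample nT) : p.RadioIdx nT → ℂ :=
  fun i => combined ω i.1 i.2.2 i.2.1

variable (p)

/-! ### The rate and the matrices of its closed form -/

/-- The information carried by a frame of `nT` minislots about the eMBB symbols, in nats. -/
def frameInfo (nT : ℕ) : ENNReal := mutualInfo (p.law nT) X R

/-- The per-user eMBB rate over a frame of `nT` minislots under OMA, in bits per radio resource:
the joint mutual information is shared equally by the `M` users, and the frame has `nT nF`
time-frequency resources. -/
def rate (nT : ℕ) : ℝ :=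
  (p.frameInfo nT).toReal / Real.log 2 / (p.M * (nT * p.nF))

/-- The equivalent fronthaul channel `γ η 1 1ᵀ + (1 - γ) I`, of size `1 / μ`. -/
def Hceta : Matrix (Fin p.m) (Fin p.m) ℝ :=
  (p.γ * p.η) • Matrix.of (fun _ _ => 1) + (1 - p.γ) • 1

/-- The overall channel `H ⊗ Hceta`. -/
def Heq : Matrix (Fin p.M × Fin p.m) (Fin p.M × Fin p.m) ℝ :=
  Matrix.kronecker p.H p.Hceta

/-- The overall noise covariance `I ⊗ Hceta Hceta + (1 / (λ² η)) I`. -/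
def Rzeq : Matrix (Fin p.M × Fin p.m) (Fin p.M × Fin p.m) ℝ :=
  Matrix.kronecker 1 (p.Hceta * p.Hceta) + (1 / (p.gain ^ 2 * p.η)) • 1

end CRAN

end

/-!
The signal chain is a linear Gaussian channel. Undoing the repetition and the crosstalk of the cable
(`CRAN.sum_Hc`, `CRAN.combined_apply`), the received vector is `A x + B z + C w` (`CRAN.R_eq`), where
the real matrices `A` and `B` act as `Heq` and `I ⊗ Hceta` in each channel use (minislot, cable
frequency), and `B Bᵀ + C Cᵀ` acts as `Rzeq` (`CRAN.noise_covariance`).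

Both `Heq` and `Rzeq` are assembled from the symmetric matrices `H` and `Hceta`, so one orthogonal
matrix `W` diagonalizes them together (`CRAN.exists_diagonalization`). White circular Gaussian
vectors stay white under orthogonal matrices, by comparison of characteristic functions
(`map_realMulVec_pi`), and the Kullback-Leibler divergence does not change under invertible maps
(`klDiv_map_of_leftInverse`, from the data processing inequality). In the coordinates given by `W`
the channel is therefore a family of independent scalar channels `y = b x + n`. The divergence is
additive over independent components (`klDiv_pi`, from the chain rule), and a scalar complex channel
with input power `P` and noise power `s` has information `log ((b² P + s) / s)`
(`klDiv_awgn_complex`), by the explicit ratio of Gaussian densities. The product of the quantities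
`(b² P + s) / s` is the determinant in the closed form (`det_one_add_smul_inv_mul_eq_prod`).

Hence a frame carries exactly `lF log det` nats per eMBB minislot (`CRAN.frameInfo_eq`). The fraction
`(nT - ⌊nT / LU⌋) / nT` of eMBB minislots is `1 - 1 / LU` when `LU` divides `nT`, and tends to it in
general.
-/

noncomputable section

open MeasureTheory ProbabilityTheory InformationTheory
open scoped Matrix Kronecker

/-! ### Kullback-Leibler divergence of images and products -/

/-- The divergence is invariant under an injection with a measurable left inverse: data processing
applies in both directions. -/
theorem klDiv_map_of_leftInverse {α β : Type*} [MeasurableSpace α] [MeasurableSpace β]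
    (μ ν : Measure α) [IsFiniteMeasure μ] [IsFiniteMeasure ν] {f : α → β} {g : β → α}
    (hf : Measurable f) (hg : Measurable g) (h : Function.LeftInverse g f) :
    klDiv (μ.map f) (ν.map f) = klDiv μ ν := by
  refine le_antisymm (klDiv_map_le μ ν hf) ?_
  have := klDiv_map_le (μ.map f) (ν.map f) hg
  rwa [Measure.map_map hg hf, Measure.map_map hg hf, h.comp_eq_id, Measure.map_id,
    Measure.map_id] at this

/-- Additivity over independent pairs: the chain rule for constant kernels, where the second summand
is reduced to `klDiv κ η` by swapping the factors. -/
theorem klDiv_prod {α β : Type*} [MeasurableSpace α] [MeasurableSpace β]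
    (μ ν : Measure α) (κ η : Measure β) [IsProbabilityMeasure μ] [IsProbabilityMeasure ν]
    [IsProbabilityMeasure κ] [IsProbabilityMeasure η] :
    klDiv (μ.prod κ) (ν.prod η) = klDiv μ ν + klDiv κ η := by
  have h1 := klDiv_compProd_eq_add μ ν (Kernel.const α κ) (Kernel.const α η)
  have h2 := klDiv_compProd_left κ η (Kernel.const β μ)
  simp only [Measure.compProd_const] at h1 h2
  rw [h1, ← h2, ← klDiv_map_of_leftInverse (μ.prod κ) (μ.prod η) measurable_swap measurable_swap
    Prod.swap_leftInverse, Measure.prod_swap, Measure.prod_swap]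

theorem klDiv_pi_fin {n : ℕ} {α : Fin n → Type*} [∀ i, MeasurableSpace (α i)]
    (μ ν : ∀ i, Measure (α i)) [∀ i, IsProbabilityMeasure (μ i)]
    [∀ i, IsProbabilityMeasure (ν i)] :
    klDiv (Measure.pi μ) (Measure.pi ν) = ∑ i, klDiv (μ i) (ν i) := by
  induction n with
  | zero =>
    rw [Measure.pi_of_empty μ, Measure.pi_of_empty ν, klDiv_self, Finset.univ_eq_empty,
      Finset.sum_empty]
  | succ n ih =>
    rw [← klDiv_map_of_leftInverse _ _ (MeasurableEquiv.piFinSuccAbove α 0).measurable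
      (MeasurableEquiv.piFinSuccAbove α 0).symm.measurable
      (MeasurableEquiv.piFinSuccAbove α 0).left_inv,
      (measurePreserving_piFinSuccAbove μ 0).map_eq,
      (measurePreserving_piFinSuccAbove ν 0).map_eq, klDiv_prod, ih, Fin.sum_univ_succ]
    rfl

theorem klDiv_pi {ι : Type*} [Fintype ι] {α : ι → Type*} [∀ i, MeasurableSpace (α i)]
    (μ ν : ∀ i, Measure (α i)) [∀ i, IsProbabilityMeasure (μ i)]
    [∀ i, IsProbabilityMeasure (ν i)] :
    klDiv (Measure.pi μ) (Measure.pi ν) = ∑ i, klDiv (μ i) (ν i) := by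
  let e := (Fintype.equivFin ι).symm
  have h := klDiv_pi_fin (fun j => μ (e j)) (fun j => ν (e j))
  rw [← klDiv_map_of_leftInverse _ _ (MeasurableEquiv.piCongrLeft α e).measurable
      (MeasurableEquiv.piCongrLeft α e).symm.measurable
      (MeasurableEquiv.piCongrLeft α e).left_inv,
      (measurePreserving_piCongrLeft μ e).map_eq,
      (measurePreserving_piCongrLeft ν e).map_eq] at h
  rw [h, e.sum_comp (fun i => klDiv (μ i) (ν i))]

/-! ### Scalar Gaussian channels -/

/-- When `μ` has density `exp g` with respect to `ν`, the log-likelihood ratio is `g`. -/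
theorem klDiv_withDensity_exp {α : Type*} [MeasurableSpace α] (μ ν : Measure α)
    [IsProbabilityMeasure μ] [IsProbabilityMeasure ν] {g : α → ℝ} (hg : Measurable g)
    (h : μ = ν.withDensity fun x => ENNReal.ofReal (Real.exp (g x))) (hi : Integrable g μ) :
    klDiv μ ν = ENNReal.ofReal (∫ x, g x ∂μ) := by
  have hac : μ ≪ ν := h ▸ withDensity_absolutelyContinuous _ _
  have hllr : llr μ ν =ᵐ[μ] g := by
    have h1 : μ.rnDeriv ν =ᵐ[ν] fun x => ENNReal.ofReal (Real.exp (g x)) := by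
      conv_lhs => rw [h]
      exact Measure.rnDeriv_withDensity ν (by fun_prop)
    filter_upwards [hac.ae_le h1] with x hx
    simp [llr, hx, ENNReal.toReal_ofReal (Real.exp_pos _).le]
  rw [klDiv_of_ac_of_integrable hac (hi.congr hllr.symm), integral_congr_ae hllr]
  simp

/-- Mutual information `log (t / s) / 2` of the scalar real channel `y = a x + n` with
`x ∼ N(0, v)`, `n ∼ N(0, s)`, written as the divergence of the law of `(x, y)` from the product of
`N(0, v)` and the law `N(0, t)` of `y`. The input variance `v` may vanish. -/
theorem klDiv_awgn_real (a : ℝ) (v : NNReal) {s t : NNReal} (hs : 0 < s)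
    (ht : (t : ℝ) = a ^ 2 * v + s) :
    klDiv (((gaussianReal 0 v).prod (gaussianReal 0 s)).map fun p => (p.1, a * p.1 + p.2))
      ((gaussianReal 0 v).prod (gaussianReal 0 t))
      = ENNReal.ofReal (Real.log (t / s) / 2) := by
  have hs' : (0 : ℝ) < s := hs
  have ht' : (0 : ℝ) < t := by rw [ht]; positivity
  have htt : t ≠ 0 := by rintro rfl; simp at ht'
  set J := ((gaussianReal 0 v).prod (gaussianReal 0 s)).map fun p => (p.1, a * p.1 + p.2) with hJ
  have hm : Measurable fun p : ℝ × ℝ => (p.1, a * p.1 + p.2) := by fun_prop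
  have : IsProbabilityMeasure J := Measure.isProbabilityMeasure_map hm.aemeasurable
  -- the logarithm of the ratio of the densities at `y` of `N(a x, s)` and `N(0, t)`
  let g : ℝ × ℝ → ℝ := fun p =>
    Real.log (t / s) / 2 - (p.2 - a * p.1) ^ 2 / (2 * s) + p.2 ^ 2 / (2 * t)
  have hg : Measurable g := by fun_prop
  have hdens : J = ((gaussianReal 0 v).prod (gaussianReal 0 t)).withDensity
      fun x => ENNReal.ofReal (Real.exp (g x)) := by
    ext A hA
    rw [withDensity_apply _ hA, hJ, Measure.map_apply hm hA, Measure.prod_apply (hm hA),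
      ← lintegral_indicator hA, lintegral_prod _ (by
        apply Measurable.aemeasurable
        exact Measurable.indicator (by fun_prop) hA)]
    congr 1
    ext x
    have hAx : MeasurableSet (Prod.mk x ⁻¹' A) := measurable_prodMk_left hA
    have e1 : gaussianReal 0 s (Prod.mk x ⁻¹' ((fun p : ℝ × ℝ => (p.1, a * p.1 + p.2)) ⁻¹' A))
        = gaussianReal (a * x) s (Prod.mk x ⁻¹' A) := by
      have := gaussianReal_map_const_add (μ := 0) (v := s) (a * x)
      rw [zero_add] at this
      rw [← this, Measure.map_apply (by fun_prop) hAx]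
      rfl
    rw [e1, gaussianReal_apply _ hs.ne', gaussianReal_of_var_ne_zero _ htt,
      lintegral_withDensity_eq_lintegral_mul _ (by fun_prop) (by
        exact Measurable.comp (Measurable.indicator (by fun_prop) hA) measurable_prodMk_left),
      ← lintegral_indicator hAx]
    congr 1
    ext y
    by_cases hy : (x, y) ∈ A
    · have hy' : y ∈ Prod.mk x ⁻¹' A := hy
      simp only [Set.indicator_of_mem hy', Pi.mul_apply, Set.indicator_of_mem hy]
      simp only [gaussianPDF]
      rw [← ENNReal.ofReal_mul (gaussianPDFReal_nonneg _ _ _)]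
      congr 1
      simp only [gaussianPDFReal, g]
      have hlog : Real.exp (Real.log (t / s) / 2) = √t / √s := by
        rw [← Real.log_sqrt (by positivity), Real.exp_log (by positivity), Real.sqrt_div' _ hs'.le]
      rw [Real.exp_add, Real.exp_sub, hlog, Real.sqrt_mul (by positivity),
        Real.sqrt_mul (by positivity) (t : ℝ), sub_zero, neg_div, neg_div, Real.exp_neg,
        Real.exp_neg]
      have := Real.sqrt_pos.2 hs'
      have := Real.sqrt_pos.2 ht'
      field_simp
    · have hy' : y ∉ Prod.mk x ⁻¹' A := hy
      simp [Set.indicator_of_notMem hy', Set.indicator_of_notMem hy]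
  -- only the first two moments of `x` and `n` enter the expectation of `g (x, a x + n)`
  have i0 : ∀ w : NNReal, Integrable (fun x : ℝ => x) (gaussianReal 0 w) := fun w =>
    (memLp_id_gaussianReal' 1 (by simp)).integrable le_rfl
  have i1 : ∀ w : NNReal, Integrable (fun x : ℝ => x ^ 2) (gaussianReal 0 w) := fun w =>
    (memLp_id_gaussianReal' 2 (by simp)).integrable_sq
  have s0 : ∀ w : NNReal, ∫ x, x ^ 2 ∂gaussianReal 0 w = w := fun w => by
    have h := variance_fun_id_gaussianReal (μ := 0) (v := w)
    rwa [variance_of_integral_eq_zero (by fun_prop) (by simp)] at h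
  have hgm : ∀ p : ℝ × ℝ, g (p.1, a * p.1 + p.2) = Real.log (t / s) / 2
      + (a ^ 2 / (2 * t) * p.1 ^ 2 + (1 / (2 * t) - 1 / (2 * s)) * p.2 ^ 2
        + a / t * (p.1 * p.2)) := by
    intro p; simp only [g]; field_simp; ring
  have j1 : Integrable (fun p : ℝ × ℝ => p.1 ^ 2) ((gaussianReal 0 v).prod (gaussianReal 0 s)) :=
    (i1 v).comp_fst _
  have j2 : Integrable (fun p : ℝ × ℝ => p.2 ^ 2) ((gaussianReal 0 v).prod (gaussianReal 0 s)) :=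
    (i1 s).comp_snd _
  have j3 : Integrable (fun p : ℝ × ℝ => p.1 * p.2) ((gaussianReal 0 v).prod (gaussianReal 0 s)) :=
    (i0 v).mul_prod (i0 s)
  have k1 := j1.const_mul (a ^ 2 / (2 * t))
  have k2 := j2.const_mul (1 / (2 * t) - 1 / (2 * s) : ℝ)
  have k3 := j3.const_mul (a / t)
  have k12 : Integrable (fun p : ℝ × ℝ => a ^ 2 / (2 * t) * p.1 ^ 2
    + (1 / (2 * t) - 1 / (2 * s)) * p.2 ^ 2) _ := k1.add k2
  have k123 : Integrable (fun p : ℝ × ℝ => a ^ 2 / (2 * t) * p.1 ^ 2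
    + (1 / (2 * t) - 1 / (2 * s)) * p.2 ^ 2 + a / t * (p.1 * p.2)) _ := k12.add k3
  have hint : Integrable (fun p : ℝ × ℝ => g (p.1, a * p.1 + p.2))
      ((gaussianReal 0 v).prod (gaussianReal 0 s)) := by
    simp_rw [hgm]
    exact (integrable_const _).add k123
  rw [klDiv_withDensity_exp J _ hg hdens
    ((integrable_map_measure hg.aestronglyMeasurable hm.aemeasurable).2 hint), hJ,
    integral_map hm.aemeasurable hg.aestronglyMeasurable]
  congr 1
  simp_rw [hgm]
  rw [integral_add (integrable_const _) k123, integral_add k12 k3, integral_add k1 k2,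
    integral_const_mul, integral_const_mul,
    integral_const_mul, integral_prod_mul (fun x : ℝ => x) (fun x : ℝ => x),
    integral_fun_fst (fun x : ℝ => x ^ 2), integral_fun_snd (fun x : ℝ => x ^ 2), s0, s0]
  simp only [integral_id_gaussianReal, probReal_univ, integral_const, smul_eq_mul]
  rw [ht]
  have : a ^ 2 * v + s ≠ 0 := by positivity
  field_simp
  ring

theorem prod_prod_prod_comm_map {α β γ δ : Type*} [MeasurableSpace α] [MeasurableSpace β]
    [MeasurableSpace γ] [MeasurableSpace δ] (μ : Measure α) (ν : Measure β) (κ : Measure γ)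
    (η : Measure δ) [SFinite μ] [SFinite ν] [SFinite κ] [SFinite η] :
    ((μ.prod ν).prod (κ.prod η)).map (fun p => ((p.1.1, p.2.1), (p.1.2, p.2.2)))
      = (μ.prod κ).prod (ν.prod η) := by
  refine Measure.ext_of_lintegral _ fun f hf => ?_
  rw [lintegral_map hf (by fun_prop), lintegral_prod _ (by fun_prop), lintegral_prod _ (by fun_prop),
    lintegral_prod _ (by fun_prop), lintegral_prod _ (by fun_prop)]
  congr 1
  ext a
  simp_rw [fun b => lintegral_prod (μ := κ) (ν := η) (fun y : γ × δ => f ((a, y.1), (b, y.2)))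
    (by fun_prop), fun c => lintegral_prod (μ := ν) (ν := η) (fun y : β × δ => f ((a, c), y))
    (by fun_prop)]
  exact lintegral_lintegral_swap (by fun_prop)

instance (v : ℝ) : IsProbabilityMeasure (complexGaussian v) :=
  Measure.isProbabilityMeasure_map (by fun_prop)

/-- The complex version of `klDiv_awgn_real`: since the gain `a` is real, the real and the imaginary
parts form two independent real channels with halved variances. -/
theorem klDiv_awgn_complex (a : ℝ) {v s : ℝ} (hv : 0 ≤ v) (hs : 0 < s) :
    klDiv (((complexGaussian v).prod (complexGaussian s)).map fun p => (p.1, (a : ℂ) * p.1 + p.2))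
      ((complexGaussian v).prod (complexGaussian (a ^ 2 * v + s)))
      = ENNReal.ofReal (Real.log ((a ^ 2 * v + s) / s)) := by
  -- `φ` assembles the pair (real parts of `x` and `y`, imaginary parts of `x` and `y`) into `(x, y)`
  let φ : (ℝ × ℝ) × (ℝ × ℝ) → ℂ × ℂ := fun p =>
    ((p.1.1 : ℂ) + (p.2.1 : ℂ) * Complex.I, (p.1.2 : ℂ) + (p.2.2 : ℂ) * Complex.I)
  let ψ : ℂ × ℂ → (ℝ × ℝ) × (ℝ × ℝ) := fun q => ((q.1.re, q.2.re), (q.1.im, q.2.im))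
  have hφ : Measurable φ := by fun_prop
  have hψ : Measurable ψ := by fun_prop
  have hψφ : Function.LeftInverse ψ φ := fun p => by simp [φ, ψ]
  have key : ∀ x y : ℝ, (complexGaussian x).prod (complexGaussian y)
      = (((gaussianReal 0 (x / 2).toNNReal).prod (gaussianReal 0 (y / 2).toNNReal)).prod
        ((gaussianReal 0 (x / 2).toNNReal).prod (gaussianReal 0 (y / 2).toNNReal))).map φ := by
    intro x y
    rw [complexGaussian, complexGaussian, Measure.map_prod_map _ _ (by fun_prop) (by fun_prop),
      ← prod_prod_prod_comm_map (gaussianReal 0 (x / 2).toNNReal)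
        (gaussianReal 0 (y / 2).toNNReal), Measure.map_map (by fun_prop) (by fun_prop)]
    rfl
  have hf : Measurable fun p : ℝ × ℝ => (p.1, a * p.1 + p.2) := by fun_prop
  set t : ℝ := a ^ 2 * v + s with ht
  have ht0 : 0 < t := by positivity
  set J := ((gaussianReal 0 (v / 2).toNNReal).prod (gaussianReal 0 (s / 2).toNNReal)).map
    fun p => (p.1, a * p.1 + p.2) with hJ
  have : IsProbabilityMeasure J := Measure.isProbabilityMeasure_map hf.aemeasurable
  have hJC : ((complexGaussian v).prod (complexGaussian s)).map
      (fun p => (p.1, (a : ℂ) * p.1 + p.2)) = (J.prod J).map φ := by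
    rw [key, hJ, Measure.map_prod_map _ _ hf hf, Measure.map_map (by fun_prop) hφ,
      Measure.map_map hφ (by fun_prop)]
    congr 1
    ext p
    · simp [φ]
    · simp [φ]; ring
  rw [hJC, key, klDiv_map_of_leftInverse _ _ hφ hψ hψφ, klDiv_prod, hJ,
    klDiv_awgn_real a _ (by simpa using hs) (by
      rw [Real.coe_toNNReal _ (by positivity), Real.coe_toNNReal _ (by positivity),
        Real.coe_toNNReal _ (by positivity), ht]
      ring), ← ENNReal.ofReal_add]
  · rw [Real.coe_toNNReal _ (by positivity), Real.coe_toNNReal _ (by positivity), add_halves]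
    congr 2
    field_simp
  all_goals
    rw [Real.coe_toNNReal _ (by positivity), Real.coe_toNNReal _ (by positivity)]
    refine div_nonneg (Real.log_nonneg ?_) zero_le_two
    rw [le_div_iff₀ (by positivity), ht]
    nlinarith [mul_nonneg (sq_nonneg a) hv]

/-! ### Real matrices acting on circular Gaussian vectors -/

theorem charFunDual_gaussianReal_zero (v : NNReal) (L : StrongDual ℝ ℝ) :
    charFunDual (gaussianReal 0 v) L = Complex.exp ((-(v * L 1 ^ 2) / 2 : ℝ)) := by
  have h : charFunDual (gaussianReal 0 v) L = charFun (gaussianReal 0 v) (L 1) := by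
    rw [charFunDual_apply, charFun_apply_real]
    congr with x
    have : L x = L 1 * x := by
      conv_lhs => rw [← mul_one x, ← smul_eq_mul, map_smul, smul_eq_mul, mul_comm]
    rw [this, Complex.ofReal_mul]
  rw [h, charFun_gaussianReal]
  congr 1
  push_cast
  ring

theorem charFunDual_complexGaussian {v : ℝ} (hv : 0 ≤ v) (L : StrongDual ℝ ℂ) :
    charFunDual (complexGaussian v) L
      = Complex.exp ((-(v * (L 1 ^ 2 + L Complex.I ^ 2)) / 4 : ℝ)) := by
  have he : (fun p : ℝ × ℝ => (p.1 : ℂ) + (p.2 : ℂ) * Complex.I)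
      = (Complex.equivRealProdCLM.symm : ℝ × ℝ →L[ℝ] ℂ) := by
    ext p; simp [Complex.equivRealProdCLM_symm_apply]
  rw [complexGaussian, he, charFunDual_map, charFunDual_prod, charFunDual_gaussianReal_zero,
    charFunDual_gaussianReal_zero, ← Complex.exp_add, ← Complex.ofReal_add,
    Real.coe_toNNReal _ (by positivity)]
  simp only [ContinuousLinearMap.comp_apply, ContinuousLinearMap.inl_apply,
    ContinuousLinearMap.inr_apply, ← he]
  congr 2
  simp only [Complex.ofReal_one, Complex.ofReal_zero, zero_mul, add_zero, zero_add, one_mul]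
  ring

theorem charFunDual_pi_complexGaussian {ι : Type*} [Fintype ι] [DecidableEq ι] {d : ι → ℝ}
    (hd : ∀ i, 0 ≤ d i) (L : StrongDual ℝ (ι → ℂ)) :
    charFunDual (Measure.pi fun i => complexGaussian (d i)) L
      = Complex.exp ((-(∑ i, d i * (L (Pi.single i 1) ^ 2 + L (Pi.single i Complex.I) ^ 2)) / 4
        : ℝ)) := by
  rw [charFunDual_pi]
  simp_rw [fun i => charFunDual_complexGaussian (hd i)]
  rw [← Complex.exp_sum, ← Complex.ofReal_sum, ← Finset.sum_neg_distrib, Finset.sum_div]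
  simp

/-- A real matrix acting on complex vectors, as a map that is continuous and linear over `ℝ`. -/
def realMulVec {κ ι : Type*} [Fintype κ] [Fintype ι] (T : Matrix κ ι ℝ) :
    (ι → ℂ) →L[ℝ] (κ → ℂ) :=
  LinearMap.toContinuousLinearMap ((T.map Complex.ofReal).mulVecLin.restrictScalars ℝ)

theorem realMulVec_apply {κ ι : Type*} [Fintype κ] [Fintype ι] (T : Matrix κ ι ℝ) (x : ι → ℂ)
    (i : κ) : realMulVec T x i = ∑ j, (T i j : ℂ) * x j := rfl

theorem realMulVec_mul {κ ι τ : Type*} [Fintype κ] [Fintype ι] [Fintype τ] (S : Matrix τ κ ℝ)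
    (T : Matrix κ ι ℝ) (x : ι → ℂ) :
    realMulVec (S * T) x = realMulVec S (realMulVec T x) := by
  change (S * T).map Complex.ofRealHom *ᵥ x = S.map Complex.ofRealHom *ᵥ
    (T.map Complex.ofRealHom *ᵥ x)
  rw [Matrix.map_mul, Matrix.mulVec_mulVec]

theorem realMulVec_one {ι : Type*} [Fintype ι] [DecidableEq ι] (x : ι → ℂ) :
    realMulVec (1 : Matrix ι ι ℝ) x = x := by
  ext i; simp [realMulVec_apply, Matrix.one_apply, apply_ite Complex.ofReal]

theorem realMulVec_diagonal {ι : Type*} [Fintype ι] [DecidableEq ι] (a : ι → ℝ) (x : ι → ℂ) :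
    realMulVec (Matrix.diagonal a) x = fun i => (a i : ℂ) * x i := by
  ext i; simp [realMulVec_apply, Matrix.diagonal_apply, apply_ite Complex.ofReal]

theorem apply_realMulVec_single {κ ι : Type*} [Fintype κ] [Fintype ι] [DecidableEq κ]
    [DecidableEq ι] (T : Matrix κ ι ℝ) (L : StrongDual ℝ (κ → ℂ)) (j : ι) (c : ℂ) :
    L (realMulVec T (Pi.single j c)) = ∑ i, T i j * L (Pi.single i c) := by
  have : realMulVec T (Pi.single j c) = ∑ i, T i j • (Pi.single i c : κ → ℂ) := by
    ext k
    simp [realMulVec_apply, Pi.single_apply]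
  rw [this, map_sum]
  simp

theorem sum_mul_sq_eq_dotProduct {κ ι : Type*} [Fintype κ] [Fintype ι] [DecidableEq ι]
    (T : Matrix κ ι ℝ) (d : ι → ℝ) (l : κ → ℝ) :
    ∑ j, d j * (∑ i, T i j * l i) ^ 2 = l ⬝ᵥ (T * Matrix.diagonal d * T.transpose) *ᵥ l := by
  rw [← Matrix.mulVec_mulVec, ← Matrix.mulVec_mulVec, Matrix.dotProduct_mulVec]
  rw [dotProduct]
  refine Finset.sum_congr rfl fun j _ => ?_
  rw [Matrix.mulVec_diagonal]
  simp only [Matrix.vecMul, Matrix.mulVec, dotProduct, Matrix.transpose_apply]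
  have : ∑ i, l i * T i j = ∑ i, T i j * l i := Finset.sum_congr rfl fun i _ => mul_comm _ _
  rw [this]
  ring

theorem charFunDual_map_realMulVec {κ ι : Type*} [Fintype κ] [Fintype ι] [DecidableEq κ]
    [DecidableEq ι] {d : ι → ℝ} (hd : ∀ i, 0 ≤ d i) (T : Matrix κ ι ℝ)
    (L : StrongDual ℝ (κ → ℂ)) :
    charFunDual ((Measure.pi fun i => complexGaussian (d i)).map (realMulVec T)) L
      = Complex.exp ((-((fun i => L (Pi.single i 1)) ⬝ᵥ
          (T * Matrix.diagonal d * T.transpose) *ᵥ (fun i => L (Pi.single i 1))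
        + (fun i => L (Pi.single i Complex.I)) ⬝ᵥ
          (T * Matrix.diagonal d * T.transpose) *ᵥ (fun i => L (Pi.single i Complex.I))) / 4
        : ℝ)) := by
  rw [charFunDual_map, charFunDual_pi_complexGaussian hd]
  simp only [ContinuousLinearMap.comp_apply, apply_realMulVec_single, mul_add,
    Finset.sum_add_distrib, sum_mul_sq_eq_dotProduct]

theorem sum_mul_sq_eq_dotProduct_diagonal {ι : Type*} [Fintype ι] [DecidableEq ι]
    (d : ι → ℝ) (l : ι → ℝ) :
    ∑ j, d j * l j ^ 2 = l ⬝ᵥ Matrix.diagonal d *ᵥ l := by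
  simp only [dotProduct, Matrix.mulVec_diagonal]
  exact Finset.sum_congr rfl fun j _ => by ring

/-- A real matrix `T` maps independent circular Gaussians of variances `d` to independent circular
Gaussians of variances `d'` as soon as `T diag(d) Tᵀ = diag(d')`. -/
theorem map_realMulVec_pi {κ ι : Type*} [Fintype κ] [Fintype ι] [DecidableEq κ]
    [DecidableEq ι] {d : ι → ℝ} {d' : κ → ℝ} (hd : ∀ i, 0 ≤ d i) (hd' : ∀ i, 0 ≤ d' i)
    (T : Matrix κ ι ℝ) (h : T * Matrix.diagonal d * T.transpose = Matrix.diagonal d') :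
    (Measure.pi fun i => complexGaussian (d i)).map (realMulVec T)
      = Measure.pi fun i => complexGaussian (d' i) := by
  have := Measure.isProbabilityMeasure_map (μ := Measure.pi fun i => complexGaussian (d i))
    (realMulVec T).measurable.aemeasurable
  refine Measure.ext_of_charFunDual (funext fun L => ?_)
  rw [charFunDual_map_realMulVec hd, h, charFunDual_pi_complexGaussian hd']
  simp only [mul_add, Finset.sum_add_distrib, sum_mul_sq_eq_dotProduct_diagonal]

/-- The analogue of `map_realMulVec_pi` for the sum of the images of two independent vectors. -/
theorem map_realMulVec_add_pi {κ ι τ : Type*} [Fintype κ] [Fintype ι] [Fintype τ]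
    [DecidableEq κ] [DecidableEq ι] [DecidableEq τ] {d : ι → ℝ} {e : τ → ℝ} {d' : κ → ℝ}
    (hd : ∀ i, 0 ≤ d i) (he : ∀ i, 0 ≤ e i) (hd' : ∀ i, 0 ≤ d' i)
    (S : Matrix κ ι ℝ) (T : Matrix κ τ ℝ)
    (h : S * Matrix.diagonal d * S.transpose + T * Matrix.diagonal e * T.transpose
      = Matrix.diagonal d') :
    ((Measure.pi fun i => complexGaussian (d i)).prod
        (Measure.pi fun i => complexGaussian (e i))).map
        (fun p => realMulVec S p.1 + realMulVec T p.2)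
      = Measure.pi fun i => complexGaussian (d' i) := by
  have i1 := Measure.isProbabilityMeasure_map (μ := Measure.pi fun i => complexGaussian (d i))
    (realMulVec S).measurable.aemeasurable
  have i2 := Measure.isProbabilityMeasure_map (μ := Measure.pi fun i => complexGaussian (e i))
    (realMulVec T).measurable.aemeasurable
  have hconv : ((Measure.pi fun i => complexGaussian (d i)).prod
        (Measure.pi fun i => complexGaussian (e i))).map
        (fun p => realMulVec S p.1 + realMulVec T p.2)
      = ((Measure.pi fun i => complexGaussian (d i)).map (realMulVec S)).conv
        ((Measure.pi fun i => complexGaussian (e i)).map (realMulVec T)) := by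
    rw [Measure.conv, Measure.map_prod_map _ _ (by fun_prop) (by fun_prop),
      Measure.map_map (by fun_prop) (by fun_prop)]
    rfl
  rw [hconv]
  refine Measure.ext_of_charFunDual (funext fun L => ?_)
  rw [charFunDual_conv, charFunDual_map_realMulVec hd, charFunDual_map_realMulVec he,
    charFunDual_pi_complexGaussian hd', ← Complex.exp_add, ← Complex.ofReal_add]
  simp only [mul_add, Finset.sum_add_distrib, sum_mul_sq_eq_dotProduct_diagonal]
  rw [← h]
  simp only [Matrix.add_mulVec, dotProduct_add]
  congr 2
  ring

/-! ### Parallel and diagonalizable Gaussian channels -/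

/-- Independent scalar channels `y i = a i * x i + n i` side by side: their mutual informations add. -/
theorem klDiv_parallel_awgn {ι : Type*} [Fintype ι] (a : ι → ℝ) {v s : ι → ℝ}
    (hv : ∀ i, 0 ≤ v i) (hs : ∀ i, 0 < s i) :
    klDiv (((Measure.pi fun i => complexGaussian (v i)).prod
        (Measure.pi fun i => complexGaussian (s i))).map
          fun p => (p.1, fun i => (a i : ℂ) * p.1 i + p.2 i))
      ((Measure.pi fun i => complexGaussian (v i)).prod
        (Measure.pi fun i => complexGaussian (a i ^ 2 * v i + s i)))
      = ENNReal.ofReal (∑ i, Real.log ((a i ^ 2 * v i + s i) / s i)) := by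
  let e := MeasurableEquiv.arrowProdEquivProdArrow ℂ ℂ ι
  have hf : ∀ i, Measurable fun p : ℂ × ℂ => (p.1, (a i : ℂ) * p.1 + p.2) := fun i => by fun_prop
  have hp : ∀ i, IsProbabilityMeasure (((complexGaussian (v i)).prod (complexGaussian (s i))).map
      fun p => (p.1, (a i : ℂ) * p.1 + p.2)) := fun i =>
    Measure.isProbabilityMeasure_map (hf i).aemeasurable
  rw [← (measurePreserving_arrowProdEquivProdArrow ℂ ℂ ι (fun i => complexGaussian (v i))
      (fun i => complexGaussian (s i))).map_eq,
    ← (measurePreserving_arrowProdEquivProdArrow ℂ ℂ ι (fun i => complexGaussian (v i))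
      (fun i => complexGaussian (a i ^ 2 * v i + s i))).map_eq,
    Measure.map_map (by fun_prop) e.measurable]
  have : (fun p : (ι → ℂ) × (ι → ℂ) => (p.1, fun i => (a i : ℂ) * p.1 i + p.2 i)) ∘ e
      = e ∘ fun x i => ((x i).1, (a i : ℂ) * (x i).1 + (x i).2) := rfl
  rw [this, ← Measure.map_map e.measurable (by fun_prop),
    klDiv_map_of_leftInverse _ _ e.measurable e.symm.measurable e.left_inv,
    Measure.pi_map_pi (f := fun i (p : ℂ × ℂ) => (p.1, (a i : ℂ) * p.1 + p.2))
      (fun i => (hf i).aemeasurable), klDiv_pi, ENNReal.ofReal_sum_of_nonneg]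
  · exact Finset.sum_congr rfl fun i _ => klDiv_awgn_complex (a i) (hv i) (hs i)
  · intro i _
    refine Real.log_nonneg ?_
    rw [le_div_iff₀ (hs i)]
    nlinarith [mul_nonneg (sq_nonneg (a i)) (hv i)]

/-- Mutual information of the vector channel `y = A x + B z + C w` with white Gaussian `x`, `z`, `w`,
when one orthogonal matrix `O` diagonalizes both the gain `A` and the noise covariance
`B Bᵀ + C Cᵀ`. Applying `O` to `x` and to `y` leaves the information unchanged and `x` white, and
turns the channel into independent scalar ones. -/
theorem mutualInfo_of_diagonalized {ι τ κ : Type*} [Fintype ι] [Fintype τ] [Fintype κ]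
    [DecidableEq ι] [DecidableEq τ] [DecidableEq κ] {v : ℝ} (hv : 0 ≤ v)
    (A O : Matrix ι ι ℝ) (B : Matrix ι τ ℝ) (C : Matrix ι κ ℝ) {a s : ι → ℝ}
    (hO : O * O.transpose = 1) (hA : O * A * O.transpose = Matrix.diagonal a)
    (hBC : O * (B * B.transpose + C * C.transpose) * O.transpose = Matrix.diagonal s)
    (hs : ∀ i, 0 < s i) :
    mutualInfo ((whiteComplexGaussian ι v).prod
        ((whiteComplexGaussian τ 1).prod (whiteComplexGaussian κ 1)))
      (fun ω => ω.1)
      (fun ω => realMulVec A ω.1 + realMulVec B ω.2.1 + realMulVec C ω.2.2)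
      = ENNReal.ofReal (∑ i, Real.log ((a i ^ 2 * v + s i) / s i)) := by
  have hO' : O.transpose * O = 1 := mul_eq_one_comm.1 hO
  simp only [mutualInfo, whiteComplexGaussian]
  set P := (Measure.pi fun _ : ι => complexGaussian v).prod
    ((Measure.pi fun _ : τ => complexGaussian 1).prod (Measure.pi fun _ : κ => complexGaussian 1))
    with hP
  set R : (ι → ℂ) × (τ → ℂ) × (κ → ℂ) → ι → ℂ := fun ω =>
    realMulVec A ω.1 + realMulVec B ω.2.1 + realMulVec C ω.2.2 with hR
  have hRm : Measurable R := by fun_prop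
  have pr1 := Measure.isProbabilityMeasure_map (μ := P)
    (f := fun ω => (ω.1, R ω)) (by fun_prop)
  have pr2 := Measure.isProbabilityMeasure_map (μ := P) (f := fun ω => ω.1) (by fun_prop)
  have pr3 := Measure.isProbabilityMeasure_map (μ := P) (f := R) hRm.aemeasurable
  have hinv : Function.LeftInverse
      (Prod.map (realMulVec O.transpose) (realMulVec O.transpose))
      (Prod.map (realMulVec O) (realMulVec O)) := by
    have : Function.LeftInverse (realMulVec O.transpose) (realMulVec O) := fun x => by
      rw [← realMulVec_mul, hO', realMulVec_one]
    exact this.prodMap this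
  rw [← klDiv_map_of_leftInverse _ _ (f := Prod.map (realMulVec O) (realMulVec O))
    (by fun_prop) (by fun_prop) hinv,
    ← Measure.map_prod_map _ _ (by fun_prop) (by fun_prop),
    Measure.map_map (by fun_prop) (by fun_prop), Measure.map_map (by fun_prop) (by fun_prop),
    Measure.map_map (by fun_prop) (by fun_prop)]
  -- the rotated output is the parallel channel applied to the rotated input and noise
  let F : (ι → ℂ) × (ι → ℂ) → (ι → ℂ) × (ι → ℂ) := fun p =>
    (p.1, fun i => (a i : ℂ) * p.1 i + p.2 i)
  let N : (ι → ℂ) × (τ → ℂ) × (κ → ℂ) → (ι → ℂ) × (ι → ℂ) :=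
    Prod.map (realMulVec O) fun q => realMulVec (O * B) q.1 + realMulVec (O * C) q.2
  have hF : Measurable F := by fun_prop
  have hN : Measurable N := by fun_prop
  have hOR : Prod.map (realMulVec O) (realMulVec O) ∘ (fun ω => (ω.1, R ω)) = F ∘ N := by
    ext1 ω
    refine Prod.ext rfl ?_
    have h1 : O * A = Matrix.diagonal a * O := by
      rw [← hA, Matrix.mul_assoc, hO', Matrix.mul_one]
    simp only [Function.comp_apply, Prod.map_snd, hR, map_add, ← realMulVec_mul, h1, F, N,
      Prod.map_fst]
    rw [realMulVec_mul, realMulVec_diagonal]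
    ext i
    simp only [Pi.add_apply]
    ring
  have hNP : P.map N = (Measure.pi fun _ : ι => complexGaussian v).prod
      (Measure.pi fun i => complexGaussian (s i)) := by
    rw [hP, ← Measure.map_prod_map _ _ (by fun_prop) (by fun_prop),
      map_realMulVec_pi (d' := fun _ => v) (fun _ => hv) (fun _ => hv),
      map_realMulVec_add_pi (d' := s) (fun _ => zero_le_one) (fun _ => zero_le_one)
        (fun i => (hs i).le)]
    · rw [← hBC]
      simp only [Matrix.diagonal_one, Matrix.transpose_mul, Matrix.mul_one, Matrix.mul_add, Matrix.add_mul,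
        Matrix.mul_assoc]
    · have : Matrix.diagonal (fun _ : ι => v) = v • (1 : Matrix ι ι ℝ) := by
        rw [← Matrix.diagonal_one, ← Matrix.diagonal_smul]; congr 1; ext; simp
      rw [this, Matrix.mul_smul, Matrix.mul_one, Matrix.smul_mul, hO]
  have hx : P.map (realMulVec O ∘ fun ω => ω.1) = Measure.pi fun _ : ι => complexGaussian v := by
    have : (realMulVec O ∘ fun ω : (ι → ℂ) × (τ → ℂ) × (κ → ℂ) => ω.1) = Prod.fst ∘ N := rfl
    rw [this, ← Measure.map_map measurable_fst hN, hNP, Measure.map_fst_prod]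
    simp
  have hy : P.map (realMulVec O ∘ R)
      = Measure.pi fun i => complexGaussian (a i ^ 2 * v + s i) := by
    have : realMulVec O ∘ R = (fun p => realMulVec (Matrix.diagonal a) p.1
        + realMulVec (1 : Matrix ι ι ℝ) p.2) ∘ N := by
      have h2 : realMulVec O ∘ R = Prod.snd ∘ (F ∘ N) := by rw [← hOR]; rfl
      rw [h2]
      ext1 ω
      simp only [Function.comp_apply, realMulVec_one, realMulVec_diagonal, F]
      rfl
    rw [this, ← Measure.map_map (by fun_prop) hN, hNP,
      map_realMulVec_add_pi (fun _ => hv) (fun i => (hs i).le)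
        (fun i => add_nonneg (mul_nonneg (sq_nonneg _) hv) (hs i).le)]
    simp only [Matrix.diagonal_mul_diagonal, Matrix.diagonal_transpose, Matrix.one_mul,
      Matrix.transpose_one, Matrix.mul_one, Matrix.diagonal_add]
    congr 1
    ext i
    ring
  rw [hOR, ← Measure.map_map hF hN, hNP, hx, hy]
  exact klDiv_parallel_awgn a (fun _ => hv) hs

/-! ### Orthogonal diagonalization and the log-determinant -/

theorem exists_orthogonal_diagonalization {n : Type*} [Fintype n] [DecidableEq n]
    {S : Matrix n n ℝ} (hS : S.IsSymm) :
    ∃ (U : Matrix n n ℝ) (d : n → ℝ), U * Uᵀ = 1 ∧ U * S * Uᵀ = Matrix.diagonal d := by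
  have hH : S.IsHermitian := by
    rwa [Matrix.IsHermitian, Matrix.conjTranspose_eq_transpose_of_trivial]
  refine ⟨(star (hH.eigenvectorUnitary : Matrix n n ℝ)), hH.eigenvalues, ?_, ?_⟩
  · have := Unitary.coe_star_mul_self hH.eigenvectorUnitary
    rwa [Matrix.star_eq_conjTranspose, Matrix.conjTranspose_eq_transpose_of_trivial]
      at this ⊢
  · have := hH.conjStarAlgAut_star_eigenvectorUnitary
    rw [Unitary.conjStarAlgAut_apply] at this
    simpa [Matrix.star_eq_conjTranspose, Matrix.conjTranspose_eq_transpose_of_trivial] using this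

theorem det_one_add_smul_inv_mul_eq_prod {n : Type*} [Fintype n] [DecidableEq n]
    {W S K : Matrix n n ℝ} {s b : n → ℝ} (hW : W * Wᵀ = 1)
    (hS : W * S * Wᵀ = Matrix.diagonal s) (hK : W * K * Wᵀ = Matrix.diagonal b)
    (hs : ∀ i, s i ≠ 0) (P : ℝ) :
    (1 + P • (S⁻¹ * (K * Kᵀ))).det = ∏ i, ((b i ^ 2 * P + s i) / s i) := by
  have hW' : Wᵀ * W = 1 := mul_eq_one_comm.1 hW
  have hS' : S = Wᵀ * Matrix.diagonal s * W := by
    rw [← hS]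
    simp only [← Matrix.mul_assoc, hW', Matrix.one_mul]
    rw [Matrix.mul_assoc, hW', Matrix.mul_one]
  have hK' : K = Wᵀ * Matrix.diagonal b * W := by
    rw [← hK]
    simp only [← Matrix.mul_assoc, hW', Matrix.one_mul]
    rw [Matrix.mul_assoc, hW', Matrix.mul_one]
  have cancel : ∀ X : Matrix n n ℝ, W * (Wᵀ * X) = X := fun X => by
    rw [← Matrix.mul_assoc, hW, Matrix.one_mul]
  have hinv : S⁻¹ = Wᵀ * Matrix.diagonal (fun i => (s i)⁻¹) * W := by
    refine Matrix.inv_eq_right_inv ?_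
    rw [hS']
    simp only [Matrix.mul_assoc, cancel]
    rw [← Matrix.mul_assoc (Matrix.diagonal s), Matrix.diagonal_mul_diagonal]
    simp [hs, hW']
  have hmain : 1 + P • (S⁻¹ * (K * Kᵀ))
      = Wᵀ * Matrix.diagonal (fun i => (b i ^ 2 * P + s i) / s i) * W := by
    have h1 : S⁻¹ * (K * Kᵀ) = Wᵀ * Matrix.diagonal (fun i => (s i)⁻¹ * (b i * b i)) * W := by
      rw [hinv, hK']
      simp only [Matrix.transpose_mul, Matrix.transpose_transpose, Matrix.diagonal_transpose,
        Matrix.mul_assoc, cancel]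
      rw [← Matrix.mul_assoc (Matrix.diagonal b), Matrix.diagonal_mul_diagonal,
        ← Matrix.mul_assoc (Matrix.diagonal _) (Matrix.diagonal _), Matrix.diagonal_mul_diagonal]
    have h2 : Matrix.diagonal (fun i => (b i ^ 2 * P + s i) / s i)
        = 1 + P • Matrix.diagonal (fun i => (s i)⁻¹ * (b i * b i)) := by
      rw [← Matrix.diagonal_one, ← Matrix.diagonal_smul, Matrix.diagonal_add]
      congr 1
      ext i
      have := hs i
      simp only [Pi.smul_apply, smul_eq_mul]
      field_simp
      ring
    rw [h1, h2, Matrix.mul_add, Matrix.add_mul, Matrix.mul_one, hW', Matrix.mul_smul,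
      Matrix.smul_mul]
  rw [hmain, Matrix.det_mul_right_comm, hW', Matrix.one_mul, Matrix.det_diagonal]

/-! ### Linear form of the fronthaul signal chain -/

namespace CRAN

variable (p : CRAN)

theorem one_sub_inv_LU_pos : 0 < 1 - (p.LU : ℝ)⁻¹ := by
  have : (2 : ℝ) ≤ p.LU := by exact_mod_cast p.two_le_LU
  rw [sub_pos]
  exact inv_lt_one_of_one_lt₀ (by linarith)

theorem PBbar_pos : 0 < p.PBbar := mul_pos p.PB_pos (inv_pos.2 p.one_sub_inv_LU_pos)

theorem gain_pos : 0 < p.gain := by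
  have := p.one_sub_inv_LU_pos
  have := p.PB_pos
  have := p.Pc_pos
  exact Real.sqrt_pos.2 (by positivity)

theorem H_isSymm : p.H.IsSymm := by
  refine Matrix.circulant_isSymm_iff.2 fun d => ?_
  have h1 : (-d = 1) ↔ d = -1 := neg_eq_iff_eq_neg
  simp only [neg_eq_zero, h1, neg_inj]
  ring

theorem Hceta_isSymm : p.Hceta.IsSymm := by
  ext i j
  simp [Hceta, Matrix.one_apply, eq_comm]

/-- Regroups a radio index (minislot, frequency, cell) into a channel use (minislot, cable frequency)
and a position (cell, sub-band). Different channel uses do not interact. -/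
def regroup (nT : ℕ) :
    p.RadioIdx nT ≃ (p.EMBBSlot nT × Fin p.lF) × (Fin p.M × Fin p.m) where
  toFun i := ((i.1, i.2.1.2), (i.2.2, i.2.1.1))
  invFun i := (i.1.1, (i.2.2, i.1.2), i.2.1)

/-- The action on the radio signals of a whole frame of a matrix `S` that acts on the
(cell, sub-band) positions, identically and separately in each channel use. -/
def frameMatrix (nT : ℕ) (S : Matrix (Fin p.M × Fin p.m) (Fin p.M × Fin p.m) ℝ) :
    Matrix (p.RadioIdx nT) (p.RadioIdx nT) ℝ :=
  ((1 : Matrix (p.EMBBSlot nT × Fin p.lF) (p.EMBBSlot nT × Fin p.lF) ℝ) ⊗ₖ S).submatrix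
    (p.regroup nT) (p.regroup nT)

variable {p} {nT : ℕ}

theorem frameMatrix_mul (S T : Matrix (Fin p.M × Fin p.m) (Fin p.M × Fin p.m) ℝ) :
    p.frameMatrix nT (S * T) = p.frameMatrix nT S * p.frameMatrix nT T := by
  rw [frameMatrix, frameMatrix, frameMatrix, Matrix.submatrix_mul_equiv,
    ← Matrix.mul_kronecker_mul, Matrix.one_mul]

theorem frameMatrix_transpose (S : Matrix (Fin p.M × Fin p.m) (Fin p.M × Fin p.m) ℝ) :
    (p.frameMatrix nT S)ᵀ = p.frameMatrix nT Sᵀ := by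
  rw [frameMatrix, frameMatrix, Matrix.transpose_submatrix, ← Matrix.kroneckerMap_transpose,
    Matrix.transpose_one]

theorem frameMatrix_diagonal (d : Fin p.M × Fin p.m → ℝ) :
    p.frameMatrix nT (Matrix.diagonal d)
      = Matrix.diagonal fun i => d (p.regroup nT i).2 := by
  rw [frameMatrix, ← Matrix.diagonal_one, Matrix.diagonal_kronecker_diagonal,
    Matrix.submatrix_diagonal_equiv]
  simp [Function.comp_def]

theorem frameMatrix_one : p.frameMatrix nT 1 = 1 := by
  rw [← Matrix.diagonal_one, frameMatrix_diagonal, Matrix.diagonal_one]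

theorem frameMatrix_add (S T : Matrix (Fin p.M × Fin p.m) (Fin p.M × Fin p.m) ℝ) :
    p.frameMatrix nT (S + T) = p.frameMatrix nT S + p.frameMatrix nT T := by
  rw [frameMatrix, Matrix.kronecker_add]; rfl

theorem frameMatrix_smul (c : ℝ) (S : Matrix (Fin p.M × Fin p.m) (Fin p.M × Fin p.m) ℝ) :
    p.frameMatrix nT (c • S) = c • p.frameMatrix nT S := by
  rw [frameMatrix, Matrix.kronecker_smul]; rfl

variable (p nT) in
/-- The matrix through which the cable noise enters `R`: the noises of the `η` pairs that carry a
sub-band are averaged and rescaled by `1 / λ`. -/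
def cableNoiseMatrix : Matrix (p.RadioIdx nT) (p.CableIdx nT) ℝ :=
  Matrix.of fun i c =>
    if c.1 = i.1 ∧ c.2.1 = i.2.2 ∧ c.2.2.1 = i.2.1.2 ∧ c.2.2.2.1 = i.2.1.1
      then (p.gain * p.η)⁻¹ else 0

theorem sum_cableIdx {E : Type*} [AddCommMonoid E] (i : p.RadioIdx nT) (g : p.CableIdx nT → E) :
    (∑ c : p.CableIdx nT,
      if c.1 = i.1 ∧ c.2.1 = i.2.2 ∧ c.2.2.1 = i.2.1.2 ∧ c.2.2.2.1 = i.2.1.1 then g c else 0)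
      = ∑ r : Fin p.η, g (i.1, i.2.2, i.2.1.2, (i.2.1.1, r)) := by
  simp only [Fintype.sum_prod_type, ite_and, Finset.sum_ite_irrel, Finset.sum_const_zero,
    Finset.sum_ite_eq', Finset.mem_univ, if_true]
  rw [Finset.sum_comm]
  simp only [Finset.sum_ite_eq', Finset.mem_univ, if_true]

theorem cableNoiseMatrix_mul_transpose :
    p.cableNoiseMatrix nT * (p.cableNoiseMatrix nT)ᵀ = (1 / (p.gain ^ 2 * p.η)) • 1 := by
  have hg := p.gain_pos
  have hη : (0 : ℝ) < p.η := by exact_mod_cast p.η_pos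
  ext i i'
  simp only [Matrix.mul_apply, Matrix.transpose_apply, cableNoiseMatrix, Matrix.of_apply, ite_mul,
    zero_mul]
  rw [sum_cableIdx i]
  have : (i.1 = i'.1 ∧ i.2.2 = i'.2.2 ∧ i.2.1.2 = i'.2.1.2 ∧ i.2.1.1 = i'.2.1.1) ↔ i = i' := by
    simp only [Prod.ext_iff]; tauto
  simp only [this, Finset.sum_const, Finset.card_univ, Fintype.card_fin, Matrix.smul_apply,
    Matrix.one_apply, smul_eq_mul, nsmul_eq_mul]
  split_ifs
  · field_simp
  · simp

/-- Summing the crosstalk over the `η` pairs that carry sub-band `j'` turns `Hc` into `Hceta`. -/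
theorem sum_Hc (j' : Fin p.m) (c : p.Pair) :
    ∑ r : Fin p.η, p.Hc (j', r) c = p.Hceta j' c.1 := by
  obtain ⟨j, i⟩ := c
  simp only [Hc, Hceta, Matrix.add_apply, Matrix.smul_apply, Matrix.of_apply, Matrix.one_apply,
    smul_eq_mul, mul_one, Prod.mk.injEq, ite_and, Finset.sum_add_distrib, Finset.sum_const,
    Finset.card_univ, Fintype.card_fin, nsmul_eq_mul, ← Finset.mul_sum, Finset.sum_ite_irrel,
    Finset.sum_ite_eq', Finset.mem_univ, if_true]
  simp
  ring

theorem combined_apply (ω : p.Sample nT) (t : p.EMBBSlot nT) (k : Fin p.M) (j : Fin p.m)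
    (f : Fin p.lF) :
    combined ω t k (j, f) = ∑ j', (p.Hceta j' j : ℂ) * Y ω t (j', f) k
      + ((p.gain * p.η)⁻¹ : ℝ) * ∑ r, ω.2.2 (t, k, f, (j, r)) := by
  have hg : (p.gain : ℂ) ≠ 0 := Complex.ofReal_ne_zero.2 p.gain_pos.ne'
  have hη : (p.η : ℂ) ≠ 0 := by
    have := p.η_pos
    exact_mod_cast (by omega : p.η ≠ 0)
  have hin : ∀ c : p.Pair, (cableInput ω t k * p.Hc.map Complex.ofReal) f c
      = p.gain * ∑ j', (p.Hceta j' c.1 : ℂ) * Y ω t (j', f) k := by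
    intro c
    simp only [Matrix.mul_apply, cableInput, unvec, Matrix.of_apply, Matrix.map_apply,
      Fintype.sum_prod_type, ← Finset.mul_sum, ← Complex.ofReal_sum, sum_Hc, mul_assoc]
    congr 1
    exact Finset.sum_congr rfl fun _ _ => mul_comm _ _
  have hout : ∀ c : p.Pair, (cableOutput ω t k) f c
      = p.gain * ∑ j', (p.Hceta j' c.1 : ℂ) * Y ω t (j', f) k + ω.2.2 (t, k, f, c) := fun c => by
    rw [← hin]; rfl
  have hG : ∀ c : p.Pair, (p.G.map Complex.ofReal) c j = if c.1 = j then (p.η : ℂ)⁻¹ else 0 := by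
    intro c
    simp [G, apply_ite Complex.ofReal]
  change (p.gain : ℂ)⁻¹ * (cableOutput ω t k * p.G.map Complex.ofReal) f j = _
  simp only [Matrix.mul_apply, hout, hG, mul_ite, mul_zero, Fintype.sum_prod_type]
  rw [Finset.sum_comm]
  simp only [Finset.sum_ite_eq', Finset.mem_univ, if_true]
  rw [← Finset.sum_mul, Finset.sum_add_distrib, Finset.sum_const, Finset.card_univ,
    Fintype.card_fin, nsmul_eq_mul]
  push_cast
  field_simp

/-- The received signal as a linear image of symbols, radio noise and cable noise. Since `H` and
`Hceta` are symmetric, row and column actions need not be distinguished. -/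
theorem R_eq (ω : p.Sample nT) :
    R ω = realMulVec (p.frameMatrix nT p.Heq) ω.1
      + realMulVec (p.frameMatrix nT (1 ⊗ₖ p.Hceta)) ω.2.1
      + realMulVec (p.cableNoiseMatrix nT) ω.2.2 := by
  ext ⟨t, ⟨j, f⟩, k⟩
  have hH : ∀ a b, p.H a b = p.H b a := fun a b => p.H_isSymm.apply b a
  have hC : ∀ a b, p.Hceta a b = p.Hceta b a := fun a b => p.Hceta_isSymm.apply b a
  have hsum : ∀ (S : Matrix (Fin p.M × Fin p.m) (Fin p.M × Fin p.m) ℝ) (x : p.RadioIdx nT → ℂ),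
      realMulVec (p.frameMatrix nT S) x (t, (j, f), k)
        = ∑ j', ∑ k', (S (k, j) (k', j') : ℂ) * x (t, (j', f), k') := by
    intro S x
    simp only [realMulVec_apply, frameMatrix, regroup, Matrix.submatrix_apply, Equiv.coe_fn_mk,
      Matrix.kronecker_apply, Matrix.one_apply, Prod.mk.injEq, ite_mul, one_mul, zero_mul,
      apply_ite Complex.ofReal, Complex.ofReal_zero, Fintype.sum_prod_type, ite_and,
      Finset.sum_ite_irrel, Finset.sum_const_zero, Finset.sum_ite_eq, Finset.mem_univ, if_true]
  rw [R, combined_apply]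
  simp only [Pi.add_apply, hsum]
  congr 1
  · rw [← Finset.sum_add_distrib]
    refine Finset.sum_congr rfl fun j' _ => ?_
    simp only [Y, Matrix.add_apply, Matrix.mul_apply, Matrix.of_apply, Matrix.map_apply, mul_add,
      Finset.mul_sum, Heq, Matrix.kronecker_apply, Matrix.one_apply, ite_mul, one_mul, zero_mul,
      apply_ite Complex.ofReal, Complex.ofReal_zero, Finset.sum_ite_eq, Finset.mem_univ, if_true]
    congr 1
    · refine Finset.sum_congr rfl fun k' _ => ?_
      rw [show p.H.kronecker p.Hceta (k, j) (k', j') = p.H k k' * p.Hceta j j' from rfl,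
        hH k k', hC j j', Complex.ofReal_mul]
      ring
    · rw [hC j j']
  · simp only [realMulVec_apply, cableNoiseMatrix, Matrix.of_apply, apply_ite Complex.ofReal,
      Complex.ofReal_zero, ite_mul, zero_mul]
    rw [sum_cableIdx (t, (j, f), k), Finset.mul_sum]

theorem noise_covariance :
    p.frameMatrix nT (1 ⊗ₖ p.Hceta) * (p.frameMatrix nT (1 ⊗ₖ p.Hceta))ᵀ
      + p.cableNoiseMatrix nT * (p.cableNoiseMatrix nT)ᵀ = p.frameMatrix nT p.Rzeq := by
  rw [frameMatrix_transpose, ← frameMatrix_mul, ← Matrix.kroneckerMap_transpose, Matrix.transpose_one,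
    p.Hceta_isSymm.eq, ← Matrix.mul_kronecker_mul, Matrix.one_mul, cableNoiseMatrix_mul_transpose,
    ← frameMatrix_one, ← frameMatrix_smul, ← frameMatrix_add]
  rfl

theorem card_EMBBSlot (nT : ℕ) : Fintype.card (p.EMBBSlot nT) = nT - nT / p.LU := by
  have h := Nat.card_multiples nT p.LU
  rw [Fintype.card_subtype_compl, Fintype.card_fin, Fintype.card_subtype, ← h,
    Finset.card_filter, Finset.card_filter,
    Fin.sum_univ_eq_sum_range fun e => if p.LU ∣ e + 1 then 1 else 0]

/-! ### Simultaneous diagonalization of gain and noise -/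

/-- The gain and the noise covariance are diagonalized together: both are built from Kronecker
products of polynomials in the symmetric matrices `H` and `Hceta`, so the product of orthogonal
diagonalizations of these two serves for both. -/
theorem exists_diagonalization (p : CRAN) :
    ∃ (W : Matrix (Fin p.M × Fin p.m) (Fin p.M × Fin p.m) ℝ) (b s : Fin p.M × Fin p.m → ℝ),
      W * Wᵀ = 1 ∧ W * p.Heq * Wᵀ = Matrix.diagonal b ∧
        W * p.Rzeq * Wᵀ = Matrix.diagonal s ∧ ∀ i, 0 < s i := by
  obtain ⟨U, d, hU, hUd⟩ := exists_orthogonal_diagonalization p.H_isSymm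
  obtain ⟨V, e, hV, hVe⟩ := exists_orthogonal_diagonalization p.Hceta_isSymm
  have hV' : Vᵀ * V = 1 := mul_eq_one_comm.1 hV
  have hc : 0 < 1 / (p.gain ^ 2 * p.η) := by
    have := p.gain_pos
    have : (0 : ℝ) < p.η := by exact_mod_cast p.η_pos
    positivity
  have hW : (U ⊗ₖ V) * (U ⊗ₖ V)ᵀ = 1 := by
    rw [← Matrix.kroneckerMap_transpose, ← Matrix.mul_kronecker_mul, hU, hV,
      Matrix.one_kronecker_one]
  refine ⟨U ⊗ₖ V, fun i => d i.1 * e i.2, fun i => e i.2 ^ 2 + 1 / (p.gain ^ 2 * p.η), hW, ?_, ?_,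
    fun i => by positivity⟩
  · change (U ⊗ₖ V) * (p.H ⊗ₖ p.Hceta) * (U ⊗ₖ V)ᵀ = _
    rw [← Matrix.kroneckerMap_transpose, ← Matrix.mul_kronecker_mul, ← Matrix.mul_kronecker_mul,
      hUd, hVe, Matrix.diagonal_kronecker_diagonal]
  · have hsq : V * (p.Hceta * p.Hceta) * Vᵀ = Matrix.diagonal fun j => e j ^ 2 := by
      have : V * (p.Hceta * p.Hceta) * Vᵀ = (V * p.Hceta * Vᵀ) * (V * p.Hceta * Vᵀ) := by
        simp only [Matrix.mul_assoc]
        rw [← Matrix.mul_assoc Vᵀ V, hV', Matrix.one_mul]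
      rw [this, hVe, Matrix.diagonal_mul_diagonal]
      simp only [pow_two]
    change (U ⊗ₖ V) * (1 ⊗ₖ (p.Hceta * p.Hceta) + (1 / (p.gain ^ 2 * p.η)) • 1) * (U ⊗ₖ V)ᵀ = _
    rw [Matrix.mul_add, Matrix.add_mul, Matrix.mul_smul, Matrix.smul_mul, Matrix.mul_one, hW,
      ← Matrix.kroneckerMap_transpose, ← Matrix.mul_kronecker_mul, ← Matrix.mul_kronecker_mul,
      Matrix.mul_one, hU, hsq, ← Matrix.diagonal_one, Matrix.diagonal_kronecker_diagonal,
      ← Matrix.diagonal_one, ← Matrix.diagonal_smul, Matrix.diagonal_add]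
    congr 1
    ext i
    simp

/-! ### Information of a frame and rate -/

/-- Each of the `|EMBBSlot nT| lF` channel uses carries `log det` nats. The nonnegativity of this
quantity shows that the truncation `ENNReal.ofReal` does not lose anything. -/
theorem frameInfo_eq (p : CRAN) (nT : ℕ) :
    p.frameInfo nT = ENNReal.ofReal ((Fintype.card (p.EMBBSlot nT) * p.lF : ℕ) *
      Real.log (1 + p.PBbar • (p.Rzeq⁻¹ * (p.Heq * p.Heqᵀ))).det) ∧
    0 ≤ Real.log (1 + p.PBbar • (p.Rzeq⁻¹ * (p.Heq * p.Heqᵀ))).det := by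
  obtain ⟨W, b, s, hW, hb, hs, hpos⟩ := p.exists_diagonalization
  have hP := p.PBbar_pos.le
  have hone : ∀ i, 1 ≤ (b i ^ 2 * p.PBbar + s i) / s i := fun i => by
    rw [le_div_iff₀ (hpos i)]
    nlinarith [mul_nonneg (sq_nonneg (b i)) hP]
  rw [det_one_add_smul_inv_mul_eq_prod hW hs hb fun i => (hpos i).ne',
    Real.log_prod fun i _ => (zero_lt_one.trans_le (hone i)).ne']
  refine ⟨?_, Finset.sum_nonneg fun i _ => Real.log_nonneg (hone i)⟩
  have hX : (X : p.Sample nT → _) = fun ω => ω.1 := rfl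
  have hR : (R : p.Sample nT → _) = _ := funext R_eq
  rw [frameInfo, law, hX, hR, mutualInfo_of_diagonalized hP (p.frameMatrix nT p.Heq)
    (p.frameMatrix nT W) (p.frameMatrix nT (1 ⊗ₖ p.Hceta)) (p.cableNoiseMatrix nT)
    (a := fun i => b (p.regroup nT i).2) (s := fun i => s (p.regroup nT i).2)]
  · congr 1
    rw [(p.regroup nT).sum_comp fun q => Real.log ((b q.2 ^ 2 * p.PBbar + s q.2) / s q.2),
      Fintype.sum_prod_type]
    simp only [Finset.sum_const, Finset.card_univ, Fintype.card_prod, Fintype.card_fin,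
      nsmul_eq_mul]
  · rw [frameMatrix_transpose, ← frameMatrix_mul, hW, frameMatrix_one]
  · rw [frameMatrix_transpose, ← frameMatrix_mul, ← frameMatrix_mul, hb, frameMatrix_diagonal]
  · rw [noise_covariance, frameMatrix_transpose, ← frameMatrix_mul, ← frameMatrix_mul, hs,
      frameMatrix_diagonal]
  · exact fun i => hpos _

theorem rate_eq (p : CRAN) (nT : ℕ) :
    p.rate nT = ((nT - nT / p.LU : ℕ) / nT : ℝ) * (p.μ * (1 / p.M) *
      Real.logb 2 (1 + p.PBbar • (p.Rzeq⁻¹ * (p.Heq * p.Heqᵀ))).det) := by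
  obtain ⟨h, h0⟩ := p.frameInfo_eq nT
  have hlF : (p.lF : ℝ) ≠ 0 := by
    have := p.lF_pos
    exact_mod_cast (by omega : p.lF ≠ 0)
  rw [rate, h, ENNReal.toReal_ofReal (by positivity), card_EMBBSlot, Real.logb, μ, nF]
  push_cast
  field_simp

theorem tendsto_eMBB_slot_ratio (p : CRAN) :
    Filter.Tendsto (fun nT : ℕ => ((nT - nT / p.LU : ℕ) / nT : ℝ)) Filter.atTop
      (nhds (1 - (p.LU : ℝ)⁻¹)) := by
  have h := (tendsto_nat_floor_mul_div_atTop (R := ℝ) (a := (p.LU : ℝ)⁻¹) (by positivity)).comp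
    (tendsto_natCast_atTop_atTop (R := ℝ))
  refine (h.const_sub 1).congr' ?_
  filter_upwards [Filter.eventually_gt_atTop 0] with n hn
  have hn' : (n : ℝ) ≠ 0 := by exact_mod_cast hn.ne'
  have hfl : ⌊(p.LU : ℝ)⁻¹ * n⌋₊ = n / p.LU := by
    rw [mul_comm, ← div_eq_mul_inv, Nat.floor_div_eq_div]
  simp only [Function.comp_apply, hfl]
  rw [Nat.cast_sub (Nat.div_le_self _ _)]
  field_simp
end CRAN

end

/-- Per-user eMBB rate under OMA: it is exact for every frame made of whole periods of `LU`
minislots, and it is the limit as the frame length tends to infinity. -/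
theorem lemma2 (p : CRAN) :
    (∀ nT : ℕ, p.frameInfo nT ≠ ⊤) ∧
    (∀ nT : ℕ, 0 < nT → p.LU ∣ nT →
      p.rate nT = p.μ * ((1 - (p.LU : ℝ)⁻¹) / p.M) *
        Real.logb 2 (1 + p.PBbar • (p.Rzeq⁻¹ * (p.Heq * p.Heq.transpose))).det) ∧
    Filter.Tendsto p.rate Filter.atTop (nhds
      (p.μ * ((1 - (p.LU : ℝ)⁻¹) / p.M) *
        Real.logb 2 (1 + p.PBbar • (p.Rzeq⁻¹ * (p.Heq * p.Heq.transpose))).det)) := by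
  have hform : p.μ * ((1 - (p.LU : ℝ)⁻¹) / p.M) *
        Real.logb 2 (1 + p.PBbar • (p.Rzeq⁻¹ * (p.Heq * p.Heq.transpose))).det
      = (1 - (p.LU : ℝ)⁻¹) * (p.μ * (1 / p.M) *
        Real.logb 2 (1 + p.PBbar • (p.Rzeq⁻¹ * (p.Heq * p.Heq.transpose))).det) := by ring
  rw [hform]
  refine ⟨fun nT => ?_, fun nT hnT hdvd => ?_, ?_⟩
  · rw [(p.frameInfo_eq nT).1]
    exact ENNReal.ofReal_ne_top
  · rw [p.rate_eq]
    congr 1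
    have hn : (nT : ℝ) ≠ 0 := by exact_mod_cast hnT.ne'
    have hL : (p.LU : ℝ) ≠ 0 := by
      have := p.two_le_LU
      exact_mod_cast (by omega : p.LU ≠ 0)
    rw [Nat.cast_sub (Nat.div_le_self _ _), Nat.cast_div hdvd hL]
    field_simp
  · rw [funext p.rate_eq]
    exact p.tendsto_eMBB_slot_ratio.mul_const _
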